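/- Let $G$ be a profinite group. For $g\in G$ let $\pi(g)$ be the set of primes dividing the (Steinitz) order of the procyclic subgroup $\overline{\langle g\rangle}$. Write $[x,y]=x^{-1}y^{-1}xy$ and $[x_1,\dots,x_k]=[[x_1,\dots,x_{k-1}],x_k]$, with $[x_1]=x_1$. For $k\ge 1$ let $\mathcal U_k(G)$ be the set of uniform $k$-step commutators of $G$, that is, of the elements $[x_1,\dots,x_k]$ with $x_1,\dots,x_k\in G$ and $\pi(x_1)=\dots=\pi(x_k)$, and let $\gamma_k(G)$ be the $k$-th term of the lower central series of $G$ (as a closed subgroup, with $\gamma_1(G)=G$). There is a function $f:\mathbb N\to\mathbb N$ such that, for all integers $k\ge 1$ and $m\ge 1$ and every profinite group $G$ with $|\mathcal U_k(G)|\le m$, the subgroup $\gamma_k(G)$ is finite and $|\gamma_k(G)|\le f(m)$. -/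

import Mathlib

namespace UniformComm

/-- The order of a profinite group as a Steinitz number `∏ p ^ n(p)`, encoded by its exponents
`n(p) ∈ {0, 1, …, ∞}`: the least common multiple of the indices of the open normal subgroups. -/
noncomputable def steinitzOrder (H : Type*) [Group H] [TopologicalSpace H] : Nat.Primes → ℕ∞ :=
  fun p => ⨆ U : OpenNormalSubgroup H, emultiplicity (p : ℕ) U.toSubgroup.index

/-- The set `π(H)` of prime divisors of the order of a profinite group `H`. -/
def primeDivisors (H : Type*) [Group H] [TopologicalSpace H] : Set Nat.Primes :=
  {p | steinitzOrder H p ≠ 0}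

variable {G : Type*} [Group G]

/-- The procyclic (that is, topologically generated by one element) subgroup generated by `g`. -/
def procyclic [TopologicalSpace G] [IsTopologicalGroup G] (g : G) : Subgroup G :=
  (Subgroup.zpowers g).topologicalClosure

/-- The set `π(g)` of prime divisors of the order of the procyclic subgroup generated by `g`. -/
def elementPrimes [TopologicalSpace G] [IsTopologicalGroup G] (g : G) : Set Nat.Primes :=
  primeDivisors (procyclic g)

/-- The commutator `[x, y] = x⁻¹ y⁻¹ x y`. -/
def comm (x y : G) : G := x⁻¹ * y⁻¹ * x * y

/-- The left-normed commutator `[x₁, …, x_k] = [[x₁, …, x_{k-1}], x_k]`, with `[x₁] = x₁`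
(and the dummy value `1` for `k = 0`). -/
def leftNormed : (k : ℕ) → (Fin k → G) → G
  | 0, _ => 1
  | 1, x => x 0
  | k + 2, x => comm (leftNormed (k + 1) (Fin.init x)) (x (Fin.last (k + 1)))

/-- The set `𝒰_k(G)` of uniform `k`-step commutators. -/
def uniformCommutators (G : Type*) [Group G] [TopologicalSpace G] [IsTopologicalGroup G]
    (k : ℕ) : Set G :=
  {g | ∃ x : Fin k → G, (∀ i j, elementPrimes (x i) = elementPrimes (x j)) ∧ g = leftNormed k x}

/-- The `k`-th term (`k ≥ 1`) of the lower central series, `γ₁(G) = G`, as a closed subgroup of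
the topological group `G`. Mathlib's lower central series is indexed from `0`. -/
def gammaSubgroup (G : Type*) [Group G] [TopologicalSpace G] [IsTopologicalGroup G]
    (k : ℕ) : Subgroup G :=
  ((⊤ : Subgroup G).lowerCentralSeries (k - 1)).topologicalClosure

end UniformComm

/-! Everything reduces to finite quotients, with a bound independent of the quotient. By compactness
every uniform commutator of a finite quotient lifts to one of `G` (`exists_lift_elementPrimes`), and
a set whose images in all finite quotients have at most `B` elements has at most `B` elements
itself.

In a finite group let `U` be the set of uniform commutators; it is invariant under conjugation. The
commutators of the subgroup generated by `U` are determined by conjugation actions on `U`, so they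
are boundedly many, and Schur's theorem bounds its derived subgroup. Modulo that subgroup the
elements of `U` commute. The elements all of whose powers lie in `U` then generate a normal subgroup
`T` of bounded order, and the quotient by `T` is Engel, hence nilpotent. In a finite nilpotent group
every left-normed commutator is uniform, by splitting into Sylow subgroups. Descending along the
lower central series, each nontrivial central last term is of bounded order and factoring it out
loses at least one uniform commutator, so the number of steps is bounded too. -/

namespace UniformComm

open scoped commutatorElement

/-! ### Commutator identities -/

section Commutators

variable {G H : Type*} [Group G] [Group H]

theorem map_comm (f : G →* H) (x y : G) : f (comm x y) = comm (f x) (f y) := by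
  simp [comm]

theorem map_leftNormed (f : G →* H) : ∀ (k : ℕ) (x : Fin k → G),
    f (leftNormed k x) = leftNormed k (fun i => f (x i))
  | 0, _ => by simp [leftNormed]
  | 1, _ => rfl
  | k + 2, x => by
    simp only [leftNormed, map_comm, map_leftNormed f (k + 1)]
    rfl

theorem leftNormed_snoc (k : ℕ) (x : Fin (k + 1) → G) (y : G) :
    leftNormed (k + 2) (Fin.snoc (α := fun _ => G) x y) = comm (leftNormed (k + 1) x) y := by
  simp [leftNormed]

theorem iterate_comm_eq_leftNormed (x a : G) : ∀ n : ℕ,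
    (fun g => comm g x)^[n] a = leftNormed (n + 1) (fun i => if i = 0 then a else x)
  | 0 => by simp [leftNormed]
  | n + 1 => by
    rw [Function.iterate_succ_apply', iterate_comm_eq_leftNormed x a n]
    have h : Fin.init (α := fun _ => G) (fun i : Fin (n + 2) => if i = 0 then a else x) =
        fun i : Fin (n + 1) => if i = 0 then a else x := by
      funext i
      simp [Fin.init]
    simp [leftNormed, h]

theorem iterate_comm_conj (x a : G) (n : ℕ) :
    (fun g => comm g x)^[n] (x⁻¹ * a * x) = x⁻¹ * (fun g => comm g x)^[n] a * x := by
  induction n with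
  | zero => rfl
  | succ n ih =>
    rw [Function.iterate_succ_apply', ih, Function.iterate_succ_apply']
    simp only [comm]
    group

theorem iterate_comm_mul_self (x a : G) (n : ℕ) :
    (fun g => comm g x)^[n + 1] (a * x) = x⁻¹ * (fun g => comm g x)^[n + 1] a * x := by
  rw [Function.iterate_succ_apply, Function.iterate_succ_apply, ← iterate_comm_conj]
  congr 1
  simp only [comm]
  group

theorem map_iterate_comm (f : G →* H) (x a : G) (n : ℕ) :
    f ((fun g => comm g x)^[n] a) = (fun g => comm g (f x))^[n] (f a) := by
  induction n with
  | zero => rfl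
  | succ n ih => rw [Function.iterate_succ_apply', map_comm, ih, Function.iterate_succ_apply']

theorem comm_mul_right (w x y : G) : comm w (x * y) = comm w y * (y⁻¹ * comm w x * y) := by
  simp only [comm]; group

theorem comm_mul_left (a b x : G) : comm (a * b) x = b⁻¹ * comm a x * b * comm b x := by
  simp only [comm]; group

theorem comm_inv_left (a x : G) : comm a⁻¹ x = a * (comm a x)⁻¹ * a⁻¹ := by
  simp only [comm]; group

theorem comm_pow_right_of_mem_center {w x : G} (h : comm w x ∈ Subgroup.center G) (j : ℕ) :
    comm w (x ^ j) = comm w x ^ j := by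
  induction j with
  | zero => simp [comm]
  | succ j ih =>
    rw [pow_succ, comm_mul_right, ih]
    have := (Subgroup.mem_center_iff.1 (Subgroup.pow_mem _ h j)) x
    rw [mul_assoc x⁻¹, ← this, inv_mul_cancel_left, ← pow_succ']

theorem comm_pow_left_of_commute {h x : G} (hc : Commute h (x⁻¹ * h * x)) (j : ℕ) :
    comm (h ^ j) x = comm h x ^ j := by
  have h1 : ∀ g : G, comm g x = g⁻¹ * (x⁻¹ * g * x) := fun g => by simp only [comm]; group
  have h2 : x⁻¹ * h ^ j * x = (x⁻¹ * h * x) ^ j := by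
    have := (conj_pow (i := j) (a := x⁻¹) (b := h)).symm
    simpa using this
  rw [h1, h1, h2, (hc.inv_left).mul_pow, inv_pow]

/-! ### Finite Engel groups -/

theorem exists_mem_normalizer_of_lt {D K : Subgroup G} [Group.IsNilpotent K] (h : D < K) :
    ∃ x ∈ K, x ∉ D ∧ x ∈ Subgroup.normalizer (D : Set G) := by
  have hlt : D.subgroupOf K < ⊤ :=
    lt_top_iff_ne_top.2 fun e => h.not_ge (Subgroup.subgroupOf_eq_top.1 e)
  obtain ⟨x, hx, hxD⟩ := SetLike.exists_of_lt (Group.normalizerCondition_of_isNilpotent _ hlt)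
  refine ⟨x, x.2, fun hD => hxD (Subgroup.mem_subgroupOf.2 hD), ?_⟩
  rw [← Subgroup.subgroupOf_normalizer_eq h.le] at hx
  exact Subgroup.mem_subgroupOf.1 hx

/-- A finite Engel group is nilpotent. -/
theorem isNilpotent_of_engel [Finite G]
    (hG : ∀ g x : G, ∃ n, (fun a => comm a x)^[n] g = 1) : Group.IsNilpotent G := by
  obtain ⟨c, hc⟩ : ∃ c, Nat.card G = c := ⟨_, rfl⟩
  induction c using Nat.strong_induction_on generalizing G with
  | _ c ih =>
  have hsub : ∀ M : Subgroup G, M ≠ ⊤ → Group.IsNilpotent M := by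
    intro M hM
    refine ih (Nat.card M) ?_ (G := M) ?_ rfl
    · rw [← hc]
      exact lt_of_le_of_ne (Subgroup.card_le_card_group M)
        fun h => hM (Subgroup.eq_top_of_card_eq M h)
    · intro g x
      obtain ⟨n, hn⟩ := hG g x
      refine ⟨n, Subtype.ext ?_⟩
      have := map_iterate_comm M.subtype x g n
      simpa using this.trans hn
  -- By induction proper subgroups are nilpotent; it remains to show that maximal subgroups are
  -- normal. A non-normal one would be self-normalizing.
  refine ((Group.isNilpotent_of_finite_tfae (G := G)).out 0 2).2 ?_
  intro M hM
  by_contra hMn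
  have hnorm : Subgroup.normalizer (M : Set G) = M := by
    rcases hM.le_iff.1 (Subgroup.le_normalizer (H := M)) with h | h
    · exact absurd (Subgroup.normalizer_eq_top_iff.1 h) hMn
    · exact h
  let conjM : G → Subgroup G := fun g => M.map (MulAut.conj g).toMonoidHom
  have mem_conjM : ∀ g y, y ∈ conjM g ↔ g⁻¹ * y * g ∈ M := by
    intro g y
    constructor
    · rintro ⟨a, ha, rfl⟩
      have : g⁻¹ * (g * a * g⁻¹) * g = a := by group
      simpa [this] using ha
    · intro h
      exact ⟨_, h, by simp [mul_assoc]⟩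
  have card_conjM : ∀ g, Nat.card (conjM g) = Nat.card M := fun g =>
    (Nat.card_congr (M.equivMapOfInjective _ (MulAut.conj g).injective).toEquiv).symm
  have hne : ∀ g, g ∉ M → conjM g ≠ M := by
    intro g hg h
    refine hg (hnorm ▸ Subgroup.mem_normalizer_iff''.2 fun a => ?_)
    rw [← mem_conjM, h]
  have hex : ({g : G | g ∉ M} : Set G).Nonempty := by
    by_contra h
    exact hM.1 ((Subgroup.eq_top_iff' M).2 fun x => by_contra fun hx => h ⟨x, hx⟩)
  -- A conjugate of `M` by an element outside `M` with largest intersection `D`. Normalizers grow in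
  -- both nilpotent groups, giving `x` and `y` that normalize `D`.
  obtain ⟨g, hg, hmax⟩ := Set.exists_max_image {g : G | g ∉ M}
    (fun g => Nat.card (M ⊓ conjM g : Subgroup G)) (Set.toFinite _) hex
  set D : Subgroup G := M ⊓ conjM g with hD
  have hDM : D < M := lt_of_le_of_ne inf_le_left fun h =>
    hne g hg (Subgroup.eq_of_le_of_card_ge (inf_eq_left.1 h) (card_conjM g).le).symm
  have hDM' : D < conjM g := lt_of_le_of_ne inf_le_right fun h =>
    hne g hg (Subgroup.eq_of_le_of_card_ge (inf_eq_right.1 h) (card_conjM g).ge)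
  have hconj_ne_top : conjM g ≠ ⊤ := fun h => hM.1
    (Subgroup.eq_top_of_card_eq M (by rw [← card_conjM g, h, Subgroup.card_top]))
  have := hsub M hM.1
  have := hsub (conjM g) hconj_ne_top
  obtain ⟨x, hxM, hxD, hxN⟩ := exists_mem_normalizer_of_lt hDM
  obtain ⟨y, hyM, hyD, hyN⟩ := exists_mem_normalizer_of_lt hDM'
  have hy : y ∉ M := fun h => hyD ⟨h, hyM⟩
  have hN : ∀ n, (fun a => comm a x)^[n] y ∈ Subgroup.normalizer (D : Set G) := by
    intro n
    induction n with
    | zero => exact hyN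
    | succ n ihn =>
      rw [Function.iterate_succ_apply']
      exact mul_mem (mul_mem (mul_mem (inv_mem ihn) (inv_mem hxN)) ihn) hxN
  have hM1 : ∃ n, (fun a => comm a x)^[n] y ∈ M := by
    obtain ⟨n, hn⟩ := hG y x
    exact ⟨n, hn ▸ one_mem M⟩
  classical
  obtain ⟨n, hn⟩ : ∃ n, Nat.find hM1 = n + 1 := by
    refine Nat.exists_eq_succ_of_ne_zero fun h => hy ?_
    have := Nat.find_spec hM1
    rwa [h] at this
  -- Let `z` be the last iterate before the sequence first enters `M`. Then `M ⊓ conjM z` contains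
  -- `D` and also `x`, against maximality.
  have hz : (fun a => comm a x)^[n] y ∉ M := Nat.find_min hM1 (by omega)
  have hz' := Nat.find_spec hM1
  rw [hn, Function.iterate_succ_apply'] at hz'
  set z := (fun a => comm a x)^[n] y
  have hxz : z⁻¹ * x * z ∈ M := by
    have h := mul_mem hxM (inv_mem hz')
    have e : x * (comm z x)⁻¹ = z⁻¹ * x * z := by simp only [comm]; group
    rwa [e] at h
  have hlt : D < M ⊓ conjM z := by
    refine lt_of_le_of_ne (fun d hd => ⟨hd.1, (mem_conjM z d).2 ?_⟩) fun h => hxD ?_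
    · exact ((Subgroup.mem_normalizer_iff''.1 (hN n) d).1 hd).1
    · rw [h]
      exact ⟨hxM, (mem_conjM z x).2 hxz⟩
  have h1 := hmax z hz
  have h2 : D = M ⊓ conjM z := Subgroup.eq_of_le_of_card_ge hlt.le h1
  exact hlt.ne h2

/-! ### Generators of the lower central series -/

theorem comm_mem_closure_comm {V : Set G} {y : G} (hy : y ∈ Subgroup.closure V) (x : G) :
    comm y x ∈ Subgroup.closure {t | ∃ v ∈ V, ∃ x : G, t = comm v x} := by
  set K := Subgroup.closure {t | ∃ v ∈ V, ∃ x : G, t = comm v x} with hK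
  have hgen : ∀ v ∈ V, ∀ x, comm v x ∈ K := fun v hv x => Subgroup.subset_closure ⟨v, hv, x, rfl⟩
  -- `K` is normal because `[v, x]` conjugated by `g` equals `[v, g]⁻¹ [v, xg]`.
  have hconj : ∀ t ∈ K, ∀ g : G, g⁻¹ * t * g ∈ K := by
    intro t ht g
    induction ht using Subgroup.closure_induction with
    | mem t ht =>
      obtain ⟨v, hv, x, rfl⟩ := ht
      have h := mul_mem (inv_mem (hgen v hv g)) (hgen v hv (x * g))
      rwa [comm_mul_right, inv_mul_cancel_left] at h
    | one => simp
    | mul a b _ _ ha hb =>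
      have : g⁻¹ * (a * b) * g = (g⁻¹ * a * g) * (g⁻¹ * b * g) := by group
      exact this ▸ mul_mem ha hb
    | inv a _ ha =>
      have : g⁻¹ * a⁻¹ * g = (g⁻¹ * a * g)⁻¹ := by group
      exact this ▸ inv_mem ha
  induction hy using Subgroup.closure_induction with
  | mem v hv => exact hgen v hv x
  | one => simp [comm]
  | mul a b _ _ ha hb =>
    rw [comm_mul_left]
    exact mul_mem (hconj _ ha b) hb
  | inv a _ ha =>
    rw [comm_inv_left]
    simpa using hconj _ (inv_mem ha) a⁻¹

theorem lowerCentralSeries_le_closure_leftNormed (j : ℕ) : ∀ n : ℕ,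
    (⊤ : Subgroup G).lowerCentralSeries (j + n) ≤ Subgroup.closure
      {t | ∃ x : Fin (n + 1) → G, x 0 ∈ (⊤ : Subgroup G).lowerCentralSeries j ∧
        t = leftNormed (n + 1) x}
  | 0 => fun y hy => Subgroup.subset_closure ⟨fun _ => y, hy, rfl⟩
  | n + 1 => by
    rw [← add_assoc, Subgroup.lowerCentralSeries_succ, Subgroup.commutator_le]
    intro y hy z _
    have h := comm_mem_closure_comm
      (inv_mem (lowerCentralSeries_le_closure_leftNormed j n hy)) z⁻¹
    have e : comm y⁻¹ z⁻¹ = ⁅y, z⁆ := by simp [comm, commutatorElement_def]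
    rw [e] at h
    refine Subgroup.closure_mono ?_ h
    rintro _ ⟨_, ⟨x, hx, rfl⟩, w, rfl⟩
    refine ⟨Fin.snoc (α := fun _ => G) x w, ?_, (leftNormed_snoc n x w).symm⟩
    have : (0 : Fin (n + 2)) = Fin.castSucc 0 := rfl
    rwa [this, Fin.snoc_castSucc (α := fun _ => G)]

theorem leftNormed_mem_lowerCentralSeries (j : ℕ) : ∀ (n : ℕ) (x : Fin (n + 1) → G),
    x 0 ∈ (⊤ : Subgroup G).lowerCentralSeries j →
      leftNormed (n + 1) x ∈ (⊤ : Subgroup G).lowerCentralSeries (j + n)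
  | 0, x, hx => hx
  | n + 1, x, hx => by
    have h := leftNormed_mem_lowerCentralSeries j n (Fin.init x) hx
    rw [← add_assoc, Subgroup.lowerCentralSeries_succ]
    have e : leftNormed (n + 1 + 1) x =
        ⁅(leftNormed (n + 1) (Fin.init x))⁻¹, (x (Fin.last (n + 1)))⁻¹⁆ := by
      simp [leftNormed, comm, commutatorElement_def]
    rw [e]
    exact Subgroup.commutator_mem_commutator (inv_mem h) (Subgroup.mem_top _)

end Commutators

end UniformComm

namespace UniformComm

open scoped commutatorElement

/-! ### Uniform commutators in finite groups -/

section FiniteGroups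

variable {G H : Type*} [Group G] [Group H]

/-- The `k`-step commutators of elements whose orders have the same prime divisors. -/
def finUniform (G : Type*) [Group G] (k : ℕ) : Set G :=
  {g | ∃ x : Fin k → G, (∀ i j, (orderOf (x i)).primeFactors = (orderOf (x j)).primeFactors) ∧
    g = leftNormed k x}

theorem leftNormed_eq_one : ∀ {k : ℕ} {x : Fin k → G} (i : Fin k), x i = 1 → leftNormed k x = 1
  | 0, _, i, _ => i.elim0
  | 1, x, i, h => by
    rw [Subsingleton.elim i 0] at h
    exact h
  | k + 2, x, i, h => by
    induction i using Fin.lastCases with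
    | last => simp [leftNormed, comm, h]
    | cast i =>
      have := leftNormed_eq_one (k := k + 1) (x := Fin.init x) i h
      simp [leftNormed, comm, this]

theorem one_mem_finUniform (n : ℕ) : (1 : G) ∈ finUniform G (n + 1) :=
  ⟨fun _ => 1, fun _ _ => rfl, (leftNormed_eq_one 0 rfl).symm⟩

theorem map_mem_finUniform {k : ℕ} (f : G →* H) (hf : Function.Injective f) {u : G}
    (hu : u ∈ finUniform G k) : f u ∈ finUniform H k := by
  obtain ⟨x, hx, rfl⟩ := hu
  refine ⟨fun i => f (x i), fun i j => ?_, map_leftNormed f k x⟩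
  rw [orderOf_injective f hf, orderOf_injective f hf, hx i j]

theorem conj_mem_finUniform {k : ℕ} {u : G} (hu : u ∈ finUniform G k) (g : G) :
    g * u * g⁻¹ ∈ finUniform G k :=
  map_mem_finUniform (MulAut.conj g).toMonoidHom (MulAut.conj g).injective hu

/-- Since `[g, x]` is the product of a conjugate of `x⁻¹` with `x`, and a right factor `x` only
conjugates further commutators with `x`, the iterate is conjugate to a left-normed commutator whose
entries all have the order of `x`. -/
theorem iterate_comm_mem_finUniform (n : ℕ) (g x : G) :
    (fun a => comm a x)^[n + 1] g ∈ finUniform G (n + 1) := by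
  cases n with
  | zero =>
    exact ⟨fun _ => comm g x, fun _ _ => rfl, rfl⟩
  | succ n =>
    have e : (fun a => comm a x)^[n + 1 + 1] g =
        x⁻¹ * (fun a => comm a x)^[n + 1] (g⁻¹ * x⁻¹ * g) * x⁻¹⁻¹ := by
      rw [inv_inv, ← iterate_comm_mul_self, Function.iterate_succ_apply]
      rfl
    rw [e]
    refine conj_mem_finUniform ?_ x⁻¹
    rw [iterate_comm_eq_leftNormed]
    refine ⟨_, ?_, rfl⟩
    have ho : orderOf (g⁻¹ * x⁻¹ * g) = orderOf x := by
      have := MulEquiv.orderOf_eq (MulAut.conj g⁻¹) x⁻¹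
      simpa using this
    have h : ∀ i : Fin (n + 1 + 1), orderOf (if i = 0 then g⁻¹ * x⁻¹ * g else x) = orderOf x := by
      intro i
      split_ifs
      · exact ho
      · rfl
    intro i j
    rw [h, h]

/-- `a` is the largest divisor of `r` whose primes all divide `d`. -/
theorem exists_coprime_mul_primeFactors_eq {r d : ℕ} (hr : r ≠ 0) (hd : d ∣ r) :
    ∃ a b : ℕ, r = a * b ∧ a.Coprime b ∧ a.primeFactors = d.primeFactors ∧ d.Coprime b := by
  obtain ⟨a, ha, hmax⟩ := Finset.exists_max_image
    (r.divisors.filter fun a => a.primeFactors ⊆ d.primeFactors) id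
    ⟨d, by simp [hd, hr]⟩
  simp only [Finset.mem_filter, Nat.mem_divisors, id] at ha hmax
  obtain ⟨⟨⟨b, rfl⟩, -⟩, hsub⟩ := ha
  have ha0 : a ≠ 0 := fun h => hr (by simp [h])
  have hd0 : d ≠ 0 := fun h => hr (by simpa [h] using hd)
  have hdb : d.Coprime b := by
    refine Nat.coprime_of_dvd fun p hp hpd hpb => ?_
    have h := hmax (a * p) ⟨⟨Nat.mul_dvd_mul_left a hpb, hr⟩, by
      rw [Nat.primeFactors_mul ha0 hp.ne_zero, hp.primeFactors]
      exact Finset.union_subset hsub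
        (Finset.singleton_subset_iff.2 (Nat.mem_primeFactors.2 ⟨hp, hpd, hd0⟩))⟩
    have := hp.two_le
    have := Nat.pos_of_ne_zero ha0
    nlinarith
  refine ⟨a, b, rfl, ?_, hsub.antisymm ?_, hdb⟩
  · refine Nat.coprime_of_dvd fun p hp hpa hpb => ?_
    have hpd := Nat.dvd_of_mem_primeFactors (hsub (Nat.mem_primeFactors.2 ⟨hp, hpa, ha0⟩))
    exact Nat.not_coprime_of_dvd_of_dvd hp.one_lt hpd hpb hdb
  · exact Nat.primeFactors_mono (hdb.dvd_of_dvd_mul_right hd) ha0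

/-- A finite-order element of a quotient lifts to an element whose order has the same primes. -/
theorem exists_lift_primeFactors_orderOf [Finite G] (f : G →* H) (x : G) :
    ∃ y : G, f y = f x ∧ (orderOf y).primeFactors = (orderOf (f x)).primeFactors := by
  have hx : orderOf x ≠ 0 := (orderOf_pos x).ne'
  have hdvd : orderOf (f x) ∣ orderOf x := orderOf_map_dvd f x
  obtain ⟨a, b, hab, hco, ha, hb⟩ := exists_coprime_mul_primeFactors_eq hx hdvd
  -- `x ^ e` loses the part of `x` at primes not dividing `orderOf (f x)`, without changing the
  -- image.
  obtain ⟨e, he1, he0⟩ := Nat.chineseRemainder hco 1 0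
  have hfa : orderOf (f x) ∣ a := hb.dvd_of_dvd_mul_right (hab ▸ hdvd)
  have hfy : f (x ^ e) = f x := by
    rw [map_pow]
    conv_rhs => rw [← pow_one (f x)]
    exact pow_eq_pow_iff_modEq.2 (he1.of_dvd hfa)
  refine ⟨x ^ e, hfy, ?_⟩
  have hya : orderOf (x ^ e) ∣ a := by
    rw [orderOf_dvd_iff_pow_eq_one, ← pow_mul, ← orderOf_dvd_iff_pow_eq_one, hab, mul_comm e]
    exact Nat.mul_dvd_mul_left a ((Nat.modEq_zero_iff_dvd).1 he0)
  apply le_antisymm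
  · rw [← ha]
    refine Nat.primeFactors_mono hya ?_
    rintro rfl
    simp [hx] at hab
  · rw [← hfy]
    exact Nat.primeFactors_mono (orderOf_map_dvd f _) (orderOf_pos _).ne'

theorem finUniform_subset_image [Finite G] (f : G →* H) (hf : Function.Surjective f) (k : ℕ) :
    finUniform H k ⊆ f '' finUniform G k := by
  rintro _ ⟨x, hx, rfl⟩
  have h : ∀ i, ∃ y : G, f y = x i ∧ (orderOf y).primeFactors = (orderOf (x i)).primeFactors := by
    intro i
    obtain ⟨z, hz⟩ := hf (x i)
    rw [← hz]
    exact exists_lift_primeFactors_orderOf f z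
  choose y hy hy' using h
  refine ⟨leftNormed k y, ⟨y, fun i j => by rw [hy', hy', hx i j], rfl⟩, ?_⟩
  rw [map_leftNormed]
  simp only [hy]

theorem mem_primeFactors_orderOf_pi {ι : Type*} [Finite ι] {A : ι → Type*} [∀ i, Group (A i)]
    [∀ i, Finite (A i)] (z : ∀ i, A i) (p : ℕ) :
    p ∈ (orderOf z).primeFactors ↔ ∃ i, p ∈ (orderOf (z i)).primeFactors := by
  have := Fintype.ofFinite ι
  have h0 : orderOf z ≠ 0 := (orderOf_pos z).ne'
  constructor
  · intro h
    have hp := Nat.prime_of_mem_primeFactors h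
    have hd : orderOf z ∣ ∏ i, orderOf (z i) := by
      rw [orderOf_dvd_iff_pow_eq_one]
      funext i
      rw [Pi.pow_apply, Pi.one_apply, ← orderOf_dvd_iff_pow_eq_one]
      exact Finset.dvd_prod_of_mem _ (Finset.mem_univ i)
    obtain ⟨i, -, hi⟩ := (hp.prime.dvd_finsetProd_iff _).1
      ((Nat.dvd_of_mem_primeFactors h).trans hd)
    exact ⟨i, Nat.mem_primeFactors.2 ⟨hp, hi, (orderOf_pos _).ne'⟩⟩
  · rintro ⟨i, hi⟩
    exact Nat.primeFactors_mono (orderOf_map_dvd (Pi.evalMonoidHom A i) z) h0 hi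

theorem leftNormed_mem_finUniform_pi {ι : Type*} [Finite ι] {A : ι → Type*} [∀ i, Group (A i)]
    [∀ i, Finite (A i)] {k : ℕ} (h : ∀ i (x : Fin k → A i), leftNormed k x ∈ finUniform (A i) k)
    (x : Fin k → ∀ i, A i) : leftNormed k x ∈ finUniform (∀ i, A i) k := by
  choose y hy hy' using fun i => h i (fun j => x j i)
  refine ⟨fun j i => y i j, fun j l => ?_, ?_⟩
  · ext p
    simp only [mem_primeFactors_orderOf_pi, hy _ j l]
  · funext i
    have h1 := map_leftNormed (Pi.evalMonoidHom A i) k x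
    have h2 := map_leftNormed (Pi.evalMonoidHom A i) k (fun j i => y i j)
    simp only [Pi.evalMonoidHom_apply] at h1 h2
    rw [h1, h2, hy' i]

/-- If all entries are nontrivial, their prime set is `{p}`; otherwise the value is `1`, given by
the trivial tuple. -/
theorem leftNormed_mem_finUniform_of_isPGroup {p : ℕ} (hp : p.Prime) (hG : IsPGroup p G) {k : ℕ}
    (x : Fin k → G) : leftNormed k x ∈ finUniform G k := by
  by_cases h : ∃ i, x i = 1
  · obtain ⟨i, hi⟩ := h
    exact ⟨fun _ => 1, fun _ _ => rfl, by
      rw [leftNormed_eq_one i hi, leftNormed_eq_one (x := fun _ => (1 : G)) i rfl]⟩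
  · push Not at h
    have key : ∀ i, (orderOf (x i)).primeFactors = {p} := by
      intro i
      have := Fact.mk hp
      obtain ⟨n, hn⟩ := IsPGroup.iff_orderOf.1 hG (x i)
      have hn0 : n ≠ 0 := by
        rintro rfl
        exact h i (orderOf_eq_one_iff.1 (by simpa using hn))
      rw [hn, Nat.primeFactors_prime_pow hn0 hp]
    exact ⟨x, fun i j => by rw [key, key], rfl⟩

theorem leftNormed_mem_finUniform_of_isNilpotent [Finite G] [hG : Group.IsNilpotent G] {k : ℕ}
    (x : Fin k → G) : leftNormed k x ∈ finUniform G k := by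
  obtain ⟨e⟩ := ((Group.isNilpotent_of_finite_tfae (G := G)).out 0 4).1 hG
  have h := leftNormed_mem_finUniform_pi (k := k) (fun p : (Nat.card G).primeFactors =>
    leftNormed_mem_finUniform_pi (fun P : Sylow p G =>
      leftNormed_mem_finUniform_of_isPGroup (Nat.prime_of_mem_primeFactors p.2) P.isPGroup'))
    (fun i => e.symm (x i))
  have h' := map_mem_finUniform e.toMonoidHom e.injective h
  rw [map_leftNormed] at h'
  simpa using h'

end FiniteGroups

/-! ### Bounds in finite groups -/

section Bounds

variable {G : Type*} [Group G]

theorem card_closure_le_pow [Finite G] {S : Set G} {m : ℕ}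
    (hcomm : ∀ a ∈ S, ∀ b ∈ S, Commute a b) (hS : S.ncard ≤ m) (hm : m ≠ 0)
    (hord : ∀ a ∈ S, orderOf a ≤ m) : Nat.card (Subgroup.closure S) ≤ m ^ m := by
  have := Fintype.ofFinite S
  have hc : Pairwise fun i j : S => ∀ x y : G, x ∈ Subgroup.zpowers (i : G) →
      y ∈ Subgroup.zpowers (j : G) → Commute x y := by
    rintro i j - _ _ ⟨a, rfl⟩ ⟨b, rfl⟩
    exact ((hcomm i i.2 j j.2).zpow_left a).zpow_right b
  have hle : Subgroup.closure S ≤ (Subgroup.noncommPiCoprod hc).range := by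
    rw [Subgroup.noncommPiCoprod_range, Subgroup.closure_le]
    intro s hs
    exact Subgroup.mem_iSup_of_mem (⟨s, hs⟩ : S) (Subgroup.mem_zpowers s)
  calc Nat.card (Subgroup.closure S) ≤ Nat.card (Subgroup.noncommPiCoprod hc).range :=
        Subgroup.card_le_of_le hle
    _ ≤ Nat.card (∀ i : S, Subgroup.zpowers (i : G)) :=
        Nat.card_le_card_of_surjective _ (MonoidHom.rangeRestrict_surjective _)
    _ = ∏ i : S, orderOf (i : G) := by
        rw [Nat.card_pi]
        exact Finset.prod_congr rfl fun i _ => Nat.card_zpowers _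
    _ ≤ ∏ _i : S, m := Finset.prod_le_prod' fun i _ => hord i i.2
    _ = m ^ S.ncard := by
        rw [Finset.prod_const, Finset.card_univ, ← Nat.card_eq_fintype_card, Nat.card_coe_set_eq]
    _ ≤ m ^ m := Nat.pow_le_pow_right (Nat.pos_of_ne_zero hm) hS

theorem orderOf_le_ncard_of_pow_mem [Finite G] {U : Set G} {t : G} (h : ∀ j : ℕ, t ^ j ∈ U) :
    orderOf t ≤ U.ncard := by
  have hsub : (Submonoid.powers t : Set G) ⊆ U := by
    rintro _ ⟨j, rfl⟩
    exact h j
  rw [← Nat.card_submonoidPowers]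
  exact Set.ncard_le_ncard hsub (Set.toFinite _)

theorem card_le_card_mul_card_map [Finite G] (L N : Subgroup G) [N.Normal] :
    Nat.card L ≤ Nat.card N * Nat.card (L.map (QuotientGroup.mk' N)) := by
  have h := Subgroup.card_mul_index ((QuotientGroup.mk' N).comp L.subtype).ker
  rw [Subgroup.index_ker, MonoidHom.range_comp, Subgroup.range_subtype, ← MonoidHom.comap_ker,
    QuotientGroup.ker_mk'] at h
  rw [← h]
  refine Nat.mul_le_mul_right _ ?_
  exact Nat.card_le_card_of_injective (fun x : N.subgroupOf L => (⟨x.1.1, x.2⟩ : N))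
    fun x y hxy => Subtype.ext (Subtype.ext (congrArg (fun z : N => (z : G)) hxy))

theorem map_mk'_lowerCentralSeries (N : Subgroup G) [N.Normal] (n : ℕ) :
    ((⊤ : Subgroup G).lowerCentralSeries n).map (QuotientGroup.mk' N) =
      (⊤ : Subgroup (G ⧸ N)).lowerCentralSeries n := by
  rw [Subgroup.map_lowerCentralSeries,
    Subgroup.map_top_of_surjective _ (QuotientGroup.mk'_surjective N)]

theorem ncard_finUniform_quotient_le [Finite G] (N : Subgroup G) [N.Normal] (k : ℕ) :
    (finUniform (G ⧸ N) k).ncard ≤ (finUniform G k).ncard :=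
  (Set.ncard_le_ncard (finUniform_subset_image _ (QuotientGroup.mk'_surjective N) k)
    (Set.toFinite _)).trans (Set.ncard_image_le (Set.toFinite _))

/-- `M` stays fixed to bound each factor, while `m` drops at each quotient and bounds the number of
factors. -/
theorem card_lowerCentralSeries_le_of_isNilpotent (n M c : ℕ) :
    ∀ (m : ℕ) (G : Type*) [Group G] [Finite G] [Group.IsNilpotent G], m ≤ M →
      (finUniform G (n + 1)).ncard ≤ m → (⊤ : Subgroup G).lowerCentralSeries (c + n) = ⊥ →
        Nat.card ((⊤ : Subgroup G).lowerCentralSeries n) ≤ (M ^ M) ^ m := by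
  induction c with
  | zero =>
    intro m G _ _ _ hmM hU h
    rw [zero_add] at h
    rw [h, Subgroup.card_bot]
    exact Nat.one_le_pow _ _ Nat.pow_self_pos
  | succ c ih =>
    intro m G _ _ _ hmM hU h
    by_cases hN : (⊤ : Subgroup G).lowerCentralSeries (c + n) = ⊥
    · exact ih m G hmM hU hN
    set N := (⊤ : Subgroup G).lowerCentralSeries (c + n) with hNdef
    have hcen : N ≤ Subgroup.center G := by
      rw [← Subgroup.commutator_top_right_eq_bot_iff_le_center, hNdef,
        ← Subgroup.lowerCentralSeries_succ, ← h]
      congr 1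
      omega
    set V : Set G := {t | ∃ x : Fin (n + 1) → G, x 0 ∈ (⊤ : Subgroup G).lowerCentralSeries c ∧
      t = leftNormed (n + 1) x} with hV
    have hVN : V ⊆ N := by
      rintro _ ⟨x, hx, rfl⟩
      exact leftNormed_mem_lowerCentralSeries c n x hx
    -- As `t` is central, a power can be moved into the last entry.
    have hVU : ∀ t ∈ V, ∀ j : ℕ, t ^ j ∈ finUniform G (n + 1) := by
      rintro t ht j
      have htc := hcen (hVN ht)
      obtain ⟨x, hx, rfl⟩ := ht
      cases n with
      | zero => exact ⟨fun _ => x 0 ^ j, fun _ _ => rfl, rfl⟩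
      | succ n =>
        have e : leftNormed (n + 1 + 1) x ^ j = leftNormed (n + 1 + 1)
            (Fin.snoc (α := fun _ => G) (Fin.init x) (x (Fin.last (n + 1)) ^ j)) := by
          rw [leftNormed_snoc]
          exact (comm_pow_right_of_mem_center htc j).symm
        rw [e]
        exact leftNormed_mem_finUniform_of_isNilpotent _
    have hVsub : V ⊆ finUniform G (n + 1) := fun t ht => by simpa using hVU t ht 1
    have hm0 : 0 < (finUniform G (n + 1)).ncard :=
      (Set.ncard_pos (Set.toFinite _)).2 ⟨1, one_mem_finUniform n⟩
    have hcard : Nat.card N ≤ M ^ M := by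
      refine (Subgroup.card_le_of_le (lowerCentralSeries_le_closure_leftNormed c n)).trans ?_
      refine card_closure_le_pow (fun a ha b _ => ?_)
        ((Set.ncard_le_ncard hVsub (Set.toFinite _)).trans (hU.trans hmM)) (by omega)
        fun a ha => (orderOf_le_ncard_of_pow_mem (hVU a ha)).trans (hU.trans hmM)
      exact (Subgroup.mem_center_iff.1 (hcen (hVN ha)) b).symm
    obtain ⟨t, htV, ht1⟩ : ∃ t ∈ V, t ≠ 1 := by
      by_contra! hcon
      refine hN (le_bot_iff.1 ((lowerCentralSeries_le_closure_leftNormed c n).trans ?_))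
      exact (Subgroup.closure_le _).2 fun t ht => Subgroup.mem_bot.2 (hcon t ht)
    obtain ⟨m, rfl⟩ : ∃ m', m = m' + 1 := ⟨m - 1, by omega⟩
    -- The distinct uniform commutators `t` and `1` coincide modulo `N`.
    have hUN : (finUniform (G ⧸ N) (n + 1)).ncard ≤ m := by
      have hsub : finUniform (G ⧸ N) (n + 1) ⊆
          QuotientGroup.mk' N '' (finUniform G (n + 1) \ {t}) := by
        intro u hu
        obtain ⟨v, hv, rfl⟩ := finUniform_subset_image _ (QuotientGroup.mk'_surjective N) _ hu
        by_cases hvt : v = t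
        · refine ⟨1, ⟨one_mem_finUniform n, fun h1 => ht1 h1.symm⟩, ?_⟩
          rw [map_one, hvt]
          exact ((QuotientGroup.eq_one_iff t).2 (hVN htV)).symm
        · exact ⟨v, ⟨hv, hvt⟩, rfl⟩
      have h1 := (Set.ncard_le_ncard hsub (Set.toFinite _)).trans
        (Set.ncard_image_le (Set.toFinite _))
      have h2 := Set.ncard_sdiff_singleton_add_one (hVsub htV) (Set.toFinite _)
      omega
    have hbot : (⊤ : Subgroup (G ⧸ N)).lowerCentralSeries (c + n) = ⊥ := by
      rw [← map_mk'_lowerCentralSeries, Subgroup.map_eq_bot_iff, QuotientGroup.ker_mk']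
    have hIH := ih m (G ⧸ N) (by omega) hUN hbot
    refine (card_le_card_mul_card_map _ N).trans ?_
    rw [map_mk'_lowerCentralSeries, pow_succ']
    exact Nat.mul_le_mul hcard hIH

theorem normal_closure_of_conj_mem {S : Set G} (h : ∀ s ∈ S, ∀ g : G, g * s * g⁻¹ ∈ S) :
    (Subgroup.closure S).Normal := by
  rw [← Subgroup.normalizer_eq_top_iff, eq_top_iff, Subgroup.le_normalizer_closure_iff]
  exact fun g _ s hs => Subgroup.subset_closure (h s hs g)

/-- On an abelian normal subgroup, commutation with `x` is an endomorphism. -/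
theorem iterate_comm_pow_of_commute {H : Subgroup G} [hH : H.Normal]
    (hcomm : ∀ a ∈ H, ∀ b ∈ H, Commute a b) (x : G) (j n : ℕ) {h : G} (hh : h ∈ H) :
    (fun a => comm a x)^[n] (h ^ j) = ((fun a => comm a x)^[n] h) ^ j := by
  induction n generalizing h with
  | zero => rfl
  | succ n ih =>
    have hx : x⁻¹ * h * x ∈ H := by simpa using hH.conj_mem h hh x⁻¹
    have hc : comm h x ∈ H := by
      have := mul_mem (inv_mem hh) hx
      simpa only [comm, mul_assoc] using this
    rw [Function.iterate_succ_apply, Function.iterate_succ_apply,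
      comm_pow_left_of_commute (hcomm h hh _ hx), ih hc]

theorem card_lowerCentralSeries_le_of_commute [Finite G] {n m : ℕ}
    (hU : (finUniform G (n + 1)).ncard ≤ m)
    (hcomm : ∀ a ∈ finUniform G (n + 1), ∀ b ∈ finUniform G (n + 1), Commute a b) :
    Nat.card ((⊤ : Subgroup G).lowerCentralSeries n) ≤ (m ^ m) ^ (m + 1) := by
  set U := finUniform G (n + 1) with hUdef
  have hm0 : 0 < U.ncard := (Set.ncard_pos (Set.toFinite _)).2 ⟨1, one_mem_finUniform n⟩
  have hnormU : (Subgroup.closure U).Normal :=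
    normal_closure_of_conj_mem fun u hu g => conj_mem_finUniform hu g
  have hcommU : ∀ a ∈ Subgroup.closure U, ∀ b ∈ Subgroup.closure U, Commute a b := by
    have := Subgroup.isMulCommutative_closure (k := U) (fun a ha b hb => hcomm a ha b hb)
    intro a ha b hb
    exact congrArg Subtype.val (mul_comm' (⟨a, ha⟩ : Subgroup.closure U) ⟨b, hb⟩)
  set S : Set G := {t | ∀ j : ℕ, t ^ j ∈ U} with hS
  have hSU : S ⊆ U := fun t ht => by simpa using ht 1
  have hnormT : (Subgroup.closure S).Normal := by
    refine normal_closure_of_conj_mem fun s hs g j => ?_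
    rw [conj_pow]
    exact conj_mem_finUniform (hs j) g
  set T := Subgroup.closure S with hT
  have hcardT : Nat.card T ≤ m ^ m :=
    card_closure_le_pow (fun a ha b hb => hcomm a (hSU ha) b (hSU hb))
      ((Set.ncard_le_ncard hSU (Set.toFinite _)).trans hU) (by omega)
      fun a ha => (orderOf_le_ncard_of_pow_mem ha).trans hU
  have hnil : Group.IsNilpotent (G ⧸ T) := by
    -- The first `n + 1` commutations land in `U`; after `n + 1` more, every power is again an
    -- iterated commutator, so the result lies in `S`.
    refine isNilpotent_of_engel fun g x => ⟨(n + 1) + (n + 1), ?_⟩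
    obtain ⟨g, rfl⟩ := QuotientGroup.mk'_surjective T g
    obtain ⟨x, rfl⟩ := QuotientGroup.mk'_surjective T x
    rw [← map_iterate_comm, QuotientGroup.mk'_apply, QuotientGroup.eq_one_iff,
      Function.iterate_add_apply]
    refine Subgroup.subset_closure fun j => ?_
    rw [← iterate_comm_pow_of_commute hcommU x j (n + 1)
      (Subgroup.subset_closure (iterate_comm_mem_finUniform n g x))]
    exact iterate_comm_mem_finUniform n _ x
  obtain ⟨c, hc⟩ := Subgroup.nilpotent_iff_lowerCentralSeries.1 hnil
  have hb := card_lowerCentralSeries_le_of_isNilpotent n m c m (G ⧸ T) le_rfl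
    ((ncard_finUniform_quotient_le T _).trans hU)
    (le_bot_iff.1 (hc ▸ Subgroup.lowerCentralSeries_antitone _ (Nat.le_add_right c n)))
  refine (card_le_card_mul_card_map _ T).trans ?_
  rw [map_mk'_lowerCentralSeries, pow_succ']
  exact Nat.mul_le_mul hcardT hb

/-- The commutator of `a` and `b` depends only on the self-maps of `U` that they induce by
conjugation, since `U` generates. -/
theorem card_commutatorSet_closure_le [Finite G] {U : Set G}
    (hU : ∀ u ∈ U, ∀ g : G, g * u * g⁻¹ ∈ U) :
    Nat.card (commutatorSet (Subgroup.closure U)) ≤ (U.ncard ^ U.ncard) ^ 2 := by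
  let act : Subgroup.closure U → U → U := fun g u => ⟨g * u * (g : G)⁻¹, hU u u.2 g⟩
  have hact : ∀ a b : Subgroup.closure U, act a = act b → ∀ v : Subgroup.closure U,
      a * v * a⁻¹ = b * v * b⁻¹ := by
    intro a b hab v
    have h : Set.EqOn (MulAut.conj (a : G)).toMonoidHom (MulAut.conj (b : G)).toMonoidHom U :=
      fun u hu => congrArg Subtype.val (congrFun hab ⟨u, hu⟩)
    exact Subtype.ext (MonoidHom.eqOn_closure h v.2)
  choose p q hpq using fun c : commutatorSet (Subgroup.closure U) => c.2
  have hinj : Function.Injective fun c => (act (p c), act (q c)) := by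
    intro c d hcd
    have h1 := hact _ _ (congrArg Prod.fst hcd)
    have h2 := hact _ _ (congrArg Prod.snd hcd)
    apply Subtype.ext
    rw [← hpq c, ← hpq d, commutatorElement_def, commutatorElement_def, h1 (q c)]
    have := h2 (p d)⁻¹
    simp only [mul_assoc] at this ⊢
    rw [this]
  refine (Nat.card_le_card_of_injective _ hinj).trans (le_of_eq ?_)
  rw [Nat.card_prod, Nat.card_fun, Nat.card_coe_set_eq, sq]

/-- A bound for the order of a term of the lower central series of a finite group in terms of the
number of its uniform commutators. -/
def orderBound (m : ℕ) : ℕ :=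
  -- Schur's bound, maximized over the possible numbers of commutators, times the bound for the
  -- commuting case.
  (Finset.range ((m ^ m) ^ 2 + 1)).sup Subgroup.cardCommutatorBound * (m ^ m) ^ (m + 1)

theorem card_lowerCentralSeries_le_orderBound [Finite G] {n m : ℕ}
    (hU : (finUniform G (n + 1)).ncard ≤ m) :
    Nat.card ((⊤ : Subgroup G).lowerCentralSeries n) ≤ orderBound m := by
  set U := finUniform G (n + 1) with hUdef
  have hm0 : 0 < U.ncard := (Set.ncard_pos (Set.toFinite _)).2 ⟨1, one_mem_finUniform n⟩
  have hconj : ∀ u ∈ U, ∀ g : G, g * u * g⁻¹ ∈ U := fun u hu g => conj_mem_finUniform hu g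
  have hnorm : (Subgroup.closure U).Normal := normal_closure_of_conj_mem hconj
  set N := ⁅Subgroup.closure U, Subgroup.closure U⁆ with hN
  have hcardN : Nat.card N ≤ (Finset.range ((m ^ m) ^ 2 + 1)).sup Subgroup.cardCommutatorBound := by
    have h1 : Nat.card N = Nat.card (commutator (Subgroup.closure U)) := by
      rw [hN, ← Subgroup.map_subtype_commutator]
      exact Nat.card_congr (Subgroup.equivMapOfInjective _ _
        (Subgroup.subtype_injective _)).toEquiv.symm
    rw [h1]
    refine (Subgroup.card_commutator_le_of_finite_commutatorSet _).trans (Finset.le_sup ?_)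
    rw [Finset.mem_range, Nat.lt_succ_iff]
    refine (card_commutatorSet_closure_le hconj).trans (Nat.pow_le_pow_left ?_ 2)
    exact (Nat.pow_le_pow_left hU _).trans (Nat.pow_le_pow_right (by omega) hU)
  have hb := card_lowerCentralSeries_le_of_commute (G := G ⧸ N)
    ((ncard_finUniform_quotient_le N (n + 1)).trans hU) (by
      intro a ha b hb
      obtain ⟨a, ha', rfl⟩ := finUniform_subset_image _ (QuotientGroup.mk'_surjective N) _ ha
      obtain ⟨b, hb', rfl⟩ := finUniform_subset_image _ (QuotientGroup.mk'_surjective N) _ hb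
      rw [← commutatorElement_eq_one_iff_commute, ← map_commutatorElement,
        QuotientGroup.mk'_apply, QuotientGroup.eq_one_iff]
      exact Subgroup.commutator_mem_commutator (Subgroup.subset_closure ha')
        (Subgroup.subset_closure hb'))
  refine (card_le_card_mul_card_map _ N).trans ?_
  rw [map_mk'_lowerCentralSeries]
  exact Nat.mul_le_mul hcardN hb

end Bounds

end UniformComm

namespace UniformComm

/-! ### Passage to profinite groups -/

section Profinite

variable {G : Type*} [Group G] [TopologicalSpace G] [IsTopologicalGroup G]

theorem index_subgroupOf_procyclic (g : G) (U : OpenNormalSubgroup G) :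
    (U.toSubgroup.subgroupOf (procyclic g)).index =
      orderOf (QuotientGroup.mk' U.toSubgroup g) := by
  have hmap : (procyclic g).map (QuotientGroup.mk' U.toSubgroup) =
      Subgroup.zpowers (QuotientGroup.mk' U.toSubgroup g) := by
    apply le_antisymm
    · rw [Subgroup.map_le_iff_le_comap]
      refine Subgroup.topologicalClosure_minimal _ ?_ (Subgroup.isClosed_of_isOpen _ ?_)
      · rw [Subgroup.zpowers_le]
        exact Subgroup.mem_zpowers _
      · refine Subgroup.isOpen_mono (H₁ := U.toSubgroup) (fun u hu => ?_) U.isOpen'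
        have : QuotientGroup.mk' U.toSubgroup u = 1 := (QuotientGroup.eq_one_iff u).2 hu
        rw [Subgroup.mem_comap, this]
        exact one_mem _
    · rw [Subgroup.zpowers_le]
      exact ⟨g, Subgroup.le_topologicalClosure _ (Subgroup.mem_zpowers g), rfl⟩
  have h := Subgroup.index_ker ((QuotientGroup.mk' U.toSubgroup).comp (procyclic g).subtype)
  rw [MonoidHom.range_comp, Subgroup.range_subtype, ← MonoidHom.comap_ker,
    QuotientGroup.ker_mk', hmap, Nat.card_zpowers] at h
  exact h

variable [CompactSpace G] [TotallyDisconnectedSpace G]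

theorem mem_elementPrimes_iff (g : G) (p : Nat.Primes) :
    p ∈ elementPrimes g ↔
      ∃ U : OpenNormalSubgroup G, (p : ℕ) ∣ orderOf (QuotientGroup.mk' U.toSubgroup g) := by
  have h : p ∈ elementPrimes g ↔
      ∃ V : OpenNormalSubgroup (procyclic g), (p : ℕ) ∣ V.toSubgroup.index := by
    simp only [elementPrimes, primeDivisors, steinitzOrder, Set.mem_ofPred_eq, ne_eq,
      ENat.iSup_eq_zero, not_forall, emultiplicity_eq_zero, not_not]
  rw [h]
  constructor
  · rintro ⟨V, hV⟩
    obtain ⟨W, hW, hWV⟩ := isOpen_induced_iff.1 V.isOpen'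
    have h1 : (1 : G) ∈ W := by
      have : (1 : procyclic g) ∈ Subtype.val ⁻¹' W := hWV ▸ V.one_mem'
      exact this
    obtain ⟨U, hU⟩ := ProfiniteGrp.exist_openNormalSubgroup_sub_open_nhds_of_one hW h1
    refine ⟨U, hV.trans ?_⟩
    rw [← index_subgroupOf_procyclic]
    refine Subgroup.index_dvd_of_le fun x hx => ?_
    have : x ∈ Subtype.val ⁻¹' W := hU hx
    rwa [hWV] at this
  · rintro ⟨U, hU⟩
    refine ⟨{ toSubgroup := U.toSubgroup.subgroupOf (procyclic g)
              isOpen' := U.isOpen'.preimage continuous_subtype_val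
              isNormal' := inferInstance }, ?_⟩
    rw [← index_subgroupOf_procyclic] at hU
    exact hU

/-- An element of a finite quotient of a profinite group lifts to an element with the same primes. -/
theorem exists_lift_elementPrimes (N : OpenNormalSubgroup G) (x : G) :
    ∃ y : G, QuotientGroup.mk' N.toSubgroup y = QuotientGroup.mk' N.toSubgroup x ∧
      elementPrimes y = {p : Nat.Primes | (p : ℕ) ∣ orderOf (QuotientGroup.mk' N.toSubgroup x)} := by
  let S : OpenNormalSubgroup G → Set G := fun U =>
    {y | QuotientGroup.mk' N.toSubgroup y = QuotientGroup.mk' N.toSubgroup x ∧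
      (orderOf (QuotientGroup.mk' U.toSubgroup y)).primeFactors ⊆
        (orderOf (QuotientGroup.mk' N.toSubgroup x)).primeFactors}
  have horder : ∀ {U V : OpenNormalSubgroup G}, U ≤ V → ∀ y : G,
      (orderOf (QuotientGroup.mk' V.toSubgroup y)).primeFactors ⊆
        (orderOf (QuotientGroup.mk' U.toSubgroup y)).primeFactors := by
    intro U V h y
    exact Nat.primeFactors_mono
      (orderOf_map_dvd (QuotientGroup.map U.toSubgroup V.toSubgroup (MonoidHom.id G) h)
        (QuotientGroup.mk' U.toSubgroup y)) (orderOf_pos _).ne'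
  have hclosed : ∀ U, IsClosed (S U) := by
    intro U
    have hd : ∀ (V : OpenNormalSubgroup G) (A : Set (G ⧸ V.toSubgroup)),
        IsClosed (QuotientGroup.mk' V.toSubgroup ⁻¹' A) := by
      intro V A
      have := QuotientGroup.discreteTopology (N := V.toSubgroup) V.isOpen'
      exact (isClosed_discrete A).preimage QuotientGroup.continuous_mk
    exact (hd N {z | z = QuotientGroup.mk' N.toSubgroup x}).inter
      (hd U {z | (orderOf z).primeFactors ⊆
        (orderOf (QuotientGroup.mk' N.toSubgroup x)).primeFactors})
  have hnonempty : ∀ U, (S U).Nonempty := by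
    intro U
    obtain ⟨z, hz, hz'⟩ := exists_lift_primeFactors_orderOf
      (QuotientGroup.map (U ⊓ N).toSubgroup N.toSubgroup (MonoidHom.id G)
        (show U ⊓ N ≤ N from inf_le_right)) (QuotientGroup.mk' (U ⊓ N).toSubgroup x)
    obtain ⟨y, rfl⟩ := QuotientGroup.mk'_surjective _ z
    exact ⟨y, hz, (horder (inf_le_left : U ⊓ N ≤ U) y).trans hz'.le⟩
  have hdir : Directed (fun A B => A ⊇ B) S := fun U V =>
    ⟨U ⊓ V, fun y hy => ⟨hy.1, (horder inf_le_left y).trans hy.2⟩,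
      fun y hy => ⟨hy.1, (horder inf_le_right y).trans hy.2⟩⟩
  have : Nonempty (OpenNormalSubgroup G) := ⟨N⟩
  -- `S U` holds the lifts with no new primes modulo `U`; the finite case makes it nonempty, and
  -- compactness gives a lift good for all `U`.
  obtain ⟨y, hy⟩ := IsCompact.nonempty_iInter_of_directed_nonempty_isCompact_isClosed S hdir
    hnonempty (fun U => (hclosed U).isCompact) hclosed
  rw [Set.mem_iInter] at hy
  refine ⟨y, (hy N).1, ?_⟩
  ext p
  rw [mem_elementPrimes_iff, Set.mem_ofPred_eq]
  constructor
  · rintro ⟨U, hU⟩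
    exact Nat.dvd_of_mem_primeFactors
      ((hy U).2 (Nat.mem_primeFactors.2 ⟨p.2, hU, (orderOf_pos _).ne'⟩))
  · intro h
    exact ⟨N, by rwa [(hy N).1]⟩

theorem finUniform_quotient_subset_image (N : OpenNormalSubgroup G) (k : ℕ) :
    finUniform (G ⧸ N.toSubgroup) k ⊆
      QuotientGroup.mk' N.toSubgroup '' uniformCommutators G k := by
  rintro _ ⟨x, hx, rfl⟩
  have h : ∀ i, ∃ y : G, QuotientGroup.mk' N.toSubgroup y = x i ∧
      elementPrimes y = {p : Nat.Primes | (p : ℕ) ∣ orderOf (x i)} := by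
    intro i
    obtain ⟨z, hz⟩ := QuotientGroup.mk'_surjective N.toSubgroup (x i)
    rw [← hz]
    exact exists_lift_elementPrimes N z
  choose y hy hy' using h
  refine ⟨leftNormed k y, ⟨y, fun i j => ?_, rfl⟩, ?_⟩
  · rw [hy', hy']
    ext p
    have hp : ∀ i, p.1 ∈ (orderOf (x i)).primeFactors ↔ p.1 ∣ orderOf (x i) := fun i =>
      ⟨Nat.dvd_of_mem_primeFactors, fun h => Nat.mem_primeFactors.2 ⟨p.2, h, (orderOf_pos _).ne'⟩⟩
    simp only [Set.mem_ofPred_eq]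
    rw [← hp, ← hp, hx i j]
  · rw [map_leftNormed]
    simp only [hy]

theorem encard_le_of_forall_openNormalSubgroup {L : Set G} {B : ℕ}
    (h : ∀ N : OpenNormalSubgroup G, (QuotientGroup.mk' N.toSubgroup '' L).encard ≤ B) :
    L.encard ≤ B := by
  by_contra! hlt
  obtain ⟨t, htL, ht⟩ := Set.exists_subset_encard_eq (Order.add_one_le_of_lt hlt)
  have htfin : t.Finite := Set.finite_of_encard_eq_coe (k := B + 1) ht
  -- An open normal subgroup avoiding the finite set `D` separates the `B + 1` points of `t`.
  set D : Set G := (fun ab : G × G => ab.1⁻¹ * ab.2) '' ((t ×ˢ t) ∩ {ab | ab.1 ≠ ab.2}) with hD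
  have hDfin : D.Finite := ((htfin.prod htfin).inter_of_left _).image _
  have h1 : (1 : G) ∈ Dᶜ := by
    rintro ⟨⟨a, b⟩, ⟨-, hab⟩, h1⟩
    exact hab (inv_mul_eq_one.1 h1)
  obtain ⟨U, hU⟩ := ProfiniteGrp.exist_openNormalSubgroup_sub_open_nhds_of_one
    hDfin.isClosed.isOpen_compl h1
  have hinj : Set.InjOn (QuotientGroup.mk' U.toSubgroup) t := by
    intro a ha b hb hab
    by_contra hne
    exact hU (QuotientGroup.eq.1 hab) ⟨(a, b), ⟨⟨ha, hb⟩, hne⟩, rfl⟩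
  have h2 := (Set.encard_le_encard (Set.image_mono htL)).trans (h U)
  rw [hinj.encard_image, ht] at h2
  exact absurd h2 (not_le.2 (by exact_mod_cast Nat.lt_succ_self B))

end Profinite

end UniformComm

theorem mainTheorem4 :
    ∃ f : ℕ → ℕ, ∀ (k m : ℕ), 1 ≤ k → 1 ≤ m →
      ∀ (G : Type*) [Group G] [TopologicalSpace G] [IsTopologicalGroup G] [CompactSpace G]
        [TotallyDisconnectedSpace G],
        (UniformComm.uniformCommutators G k).encard ≤ (m : ℕ∞) →
          Finite (UniformComm.gammaSubgroup G k) ∧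
            Nat.card (UniformComm.gammaSubgroup G k) ≤ f m := by
  refine ⟨UniformComm.orderBound, fun k m hk _ G _ _ _ _ _ hU => ?_⟩
  obtain ⟨n, rfl⟩ : ∃ n, k = n + 1 := ⟨k - 1, by omega⟩
  set L := (⊤ : Subgroup G).lowerCentralSeries n with hL
  have hcard : (L : Set G).encard ≤ UniformComm.orderBound m := by
    refine UniformComm.encard_le_of_forall_openNormalSubgroup fun N => ?_
    have hUN : (UniformComm.finUniform (G ⧸ N.toSubgroup) (n + 1)).ncard ≤ m := by
      have h := (Set.encard_le_encard (UniformComm.finUniform_quotient_subset_image N (n + 1))).trans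
        ((Set.encard_image_le _ _).trans hU)
      rw [← (Set.toFinite _).cast_ncard_eq] at h
      exact_mod_cast h
    have hb := UniformComm.card_lowerCentralSeries_le_orderBound hUN
    rw [← UniformComm.map_mk'_lowerCentralSeries, ← SetLike.coe_sort_coe, Nat.card_coe_set_eq,
      Subgroup.coe_map] at hb
    rw [← (Set.toFinite _).cast_ncard_eq]
    exact_mod_cast hb
  have hfin : (L : Set G).Finite := Set.finite_of_encard_le_coe hcard
  -- The abstract term is finite, hence already closed.
  have hgamma : UniformComm.gammaSubgroup G (n + 1) = L :=
    SetLike.coe_injective (hfin.isClosed.closure_eq)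
  rw [hgamma]
  refine ⟨hfin, ?_⟩
  rw [← hfin.cast_ncard_eq] at hcard
  exact_mod_cast hcard
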